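/- Let $n\ge 1$, and let $X$ be a random vector in $\mathbb R^n$ with a density $f$ (with respect to Lebesgue measure) of the form $f=\varphi^{-\beta}$ on $\Omega$ and $f=0$ outside $\Omega$, where $\varphi$ is a positive convex function on an open convex set $\Omega\subset\mathbb R^n$ and $\beta\ge n+1$. Let $\|f\|=\operatorname{ess\,sup} f$ and $h(X)=-\int_{\mathbb R^n} f\log f\,dx$. Then $0<\|f\|<\infty$, the function $f\log f$ is integrable, and the following hold. (1) If $\beta_0>1$ and $\beta\ge\beta_0 n$ (and $\beta\ge n+1$), then $$\frac1n h(X)\le \frac{\beta_0}{\beta_0-1}+\log\|f\|^{-1/n}.$$ (2) If $\beta_0\ge 1$ and $\beta\ge\beta_0+n$, then $$\frac1n h(X)\le \log\|f\|^{-1/n}+\frac{\beta_0+n}{n}\sum_{i=1}^n\frac1{\beta_0+n-i}\le \log\|f\|^{-1/n}+E_{\beta_0}(n),$$ where $$E_{\beta_0}(n)=\Big(1+\frac{\beta_0}{n}\Big)\Big[\frac{1}{\beta_0}+\log\Big(1+\frac{n-1}{\beta_0}\Big)\Big],$$ and, for each fixed $\beta_0\ge1$, $E_{\beta_0}(n)=O(\log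 n)$ as $n\to\infty$. In particular $\frac1n h(X)\le \log\|f\|^{-1/n}+O(\log n)$. -/

import Mathlib

open MeasureTheory

/-- The `L^∞` norm (essential supremum with respect to Lebesgue measure) of a function on `ℝⁿ`. -/
noncomputable def maxDensity {n : ℕ} (f : EuclideanSpace ℝ (Fin n) → ℝ) : ℝ :=
  (eLpNorm f ⊤ volume).toReal

/-- The entropy functional `h(f) = -∫ f(x) log f(x) dx` of a density on `ℝⁿ`
(natural logarithm, with `0 log 0 = 0`). -/
noncomputable def densityEntropy {n : ℕ} (f : EuclideanSpace ℝ (Fin n) → ℝ) : ℝ :=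
  -∫ x, f x * Real.log (f x)

/-- The differential entropy `h(X)` of a random vector `X` in `ℝⁿ`: the entropy of the density of
`X` with respect to Lebesgue measure (it does not depend on the version of the density). -/
noncomputable def diffEntropy {S : Type*} [MeasurableSpace S] (P : Measure S) {n : ℕ}
    (X : S → EuclideanSpace ℝ (Fin n)) : ℝ :=
  densityEntropy fun x => (pdf X P volume x).toReal

/-- `f = φ^{-β}` on `Ω`, where `φ` is a positive convex function on the open convex set `Ω ⊆ ℝⁿ`;
`f` is zero outside `Ω`. -/
def IsConvexPower {n : ℕ} (β : ℝ) (f : EuclideanSpace ℝ (Fin n) → ℝ) : Prop :=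
  ∃ (Ω : Set (EuclideanSpace ℝ (Fin n))) (φ : EuclideanSpace ℝ (Fin n) → ℝ),
    IsOpen Ω ∧ Convex ℝ Ω ∧ (∀ x ∈ Ω, 0 < φ x) ∧ ConvexOn ℝ Ω φ ∧
      (∀ x ∈ Ω, f x = φ x ^ (-β)) ∧ ∀ x ∉ Ω, f x = 0

/-- The random vector `X` has density `f` with respect to Lebesgue measure on `ℝⁿ`
(for `f ≥ 0`). -/
def HasDensity {S : Type*} [MeasurableSpace S] (P : Measure S) {n : ℕ}
    (X : S → EuclideanSpace ℝ (Fin n)) (f : EuclideanSpace ℝ (Fin n) → ℝ) : Prop :=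
  AEMeasurable X P ∧ P.map X = volume.withDensity fun x => ENNReal.ofReal (f x)

/-- The error term in the form of a sum, `((β₀ + n)/n) ∑_{i=1}^n 1/(β₀ + n - i)`. -/
noncomputable def errorSum (β₀ : ℝ) (n : ℕ) : ℝ :=
  (β₀ + n) / n * ∑ i ∈ Finset.Icc 1 n, 1 / (β₀ + n - i)

/-- The closed-form error term `(1 + β₀/n) (1/β₀ + log (1 + (n - 1)/β₀))`. -/
noncomputable def errorTerm (β₀ : ℝ) (n : ℕ) : ℝ :=
  (1 + β₀ / n) * (1 / β₀ + Real.log (1 + ((n : ℝ) - 1) / β₀))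

/-!
Let `f = φ ^ (-β)` be a probability density on `Ω ⊆ ℝⁿ` with `φ` convex, and let `m = inf φ`, so
that `‖f‖ = m ^ (-β)` and `h(f) = β ∫ f log φ`. The whole theorem reduces to the inequality

  `∫ f log (φ / m) ≤ ∑_{i=1}^n 1 / (β - i)`,

which is an equality when `φ - m` is a positively homogeneous function.

Contracting towards a point where `φ` is close to its infimum shows that `V t / (t - 1) ^ n` is
nonincreasing in `t > 1`, where `V t` is the volume of `{φ ≤ m t}`
(`ConvexOn.measureReal_sublevel_mono`). This replaces the Brunn–Minkowski inequality and polar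
coordinates, and it does not need the infimum to be attained. If `m` were `0`, the same monotonicity
would contradict Markov's inequality for `f`, since `β > n`
(`ConvexOn.pos_of_isGLB_of_integrable_rpow`); hence `‖f‖` is finite.

Writing `g = φ / m` and `C = ∑_{i=1}^n 1 / (β - i)`, the layer-cake formula gives

  `∫ g ^ (-β) (log g - C) dx = ∫_1^∞ w(t) V t dt`,  `w(t) = -(d/dt) (t ^ (-β) (log t - C))`,

and `w` changes sign once, from negative to positive. Since `V t / (t - 1) ^ n` is nonincreasing,
the right-hand side is at most a constant times `∫_1^∞ w(t) (t - 1) ^ n dt`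
(`logWeight_zero_mul_le`, `integral_logWeight_comp_nonpos`). The last integral is zero precisely
because `C` is the stated sum (`integral_logWeight_harmonic`). The same domination of `V` by a power
of order `n` yields the integrability of `f log f`.

The two ranges of `β` follow by monotonicity of `β ↦ β / (β - i)`, and the closed form of the error
term from the comparison of a harmonic-type sum with a logarithm.
-/

/-! ### Logarithmic moments of the Pareto-type weight `t ^ (-p) * (t - 1) ^ j` -/

/-- The kernel `t ^ (-p) * (log t - S) * (t - 1) ^ j` on `(1, ∞)`. For `S > 0` it
changes sign exactly once there, at `t = exp S`, from negative to positive. -/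
noncomputable def logWeight (p S : ℝ) (j : ℕ) (t : ℝ) : ℝ :=
  t ^ (-p) * (Real.log t - S) * (t - 1) ^ j

lemma logWeight_eq_mul_pow (p S : ℝ) (j : ℕ) (t : ℝ) :
    logWeight p S j t = logWeight p S 0 t * (t - 1) ^ j := by
  simp [logWeight]

lemma hasDerivAt_logWeight {p : ℝ} (hp : p ≠ 0) (S : ℝ) (j : ℕ) {t : ℝ} (ht : 0 < t) :
    HasDerivAt (logWeight p S j)
      (-p * logWeight (p + 1) (S + 1 / p) j t + j * logWeight p S (j - 1) t) t := by
  have h1 : HasDerivAt (fun t : ℝ => t ^ (-p)) (-p * t ^ (-p - 1)) t :=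
    Real.hasDerivAt_rpow_const (Or.inl ht.ne')
  have h2 : HasDerivAt (fun t : ℝ => Real.log t - S) t⁻¹ t :=
    (Real.hasDerivAt_log ht.ne').sub_const S
  have h3 : HasDerivAt (fun t : ℝ => (t - 1) ^ j) (j * (t - 1) ^ (j - 1) * 1) t :=
    ((hasDerivAt_id t).sub_const 1).pow j
  refine HasDerivAt.congr_deriv (f := logWeight p S j) ((h1.mul h2).mul h3) ?_
  have e1 : t ^ (-(p + 1)) = t ^ (-p) * t⁻¹ := by
    rw [← Real.rpow_neg_one t, ← Real.rpow_add ht]; ring_nf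
  have e2 : t ^ (-p - 1) = t ^ (-p) * t⁻¹ := by
    rw [← Real.rpow_neg_one t, ← Real.rpow_add ht]; ring_nf
  simp only [logWeight, Pi.mul_apply, e1, e2]
  field_simp
  ring

lemma abs_logWeight_le (p S : ℝ) (j : ℕ) {ε t : ℝ} (hε : 0 < ε) (ht : 1 ≤ t) :
    |logWeight p S j t| ≤ t ^ (-(p - j - ε)) / ε + |S| * t ^ (-(p - j)) := by
  have ht0 : 0 < t := by linarith
  have hlog : 0 ≤ Real.log t := Real.log_nonneg ht
  have h1 : |Real.log t - S| ≤ t ^ ε / ε + |S| := by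
    refine (abs_sub _ _).trans ?_
    rw [abs_of_nonneg hlog]
    linarith [Real.log_le_rpow_div ht0.le hε]
  have h2 : |(t - 1) ^ j| ≤ t ^ (j : ℝ) := by
    rw [abs_of_nonneg (pow_nonneg (by linarith) j), Real.rpow_natCast]
    exact pow_le_pow_left₀ (by linarith) (by linarith) j
  rw [logWeight, abs_mul, abs_mul, abs_of_pos (Real.rpow_pos_of_pos ht0 _)]
  have e1 : t ^ (-(p - j - ε)) = t ^ (-p) * t ^ ε * t ^ (j : ℝ) := by
    rw [← Real.rpow_add ht0, ← Real.rpow_add ht0]; ring_nf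
  have e2 : t ^ (-(p - j)) = t ^ (-p) * t ^ (j : ℝ) := by
    rw [← Real.rpow_add ht0]; ring_nf
  rw [e1, e2]
  calc t ^ (-p) * |Real.log t - S| * |(t - 1) ^ j|
      ≤ t ^ (-p) * (t ^ ε / ε + |S|) * t ^ (j : ℝ) := by gcongr
    _ = _ := by ring

lemma measurable_logWeight (p S : ℝ) (j : ℕ) : Measurable (logWeight p S j) := by
  unfold logWeight
  fun_prop

lemma integrableOn_logWeight {p : ℝ} (S : ℝ) {j : ℕ} (hp : j + 1 < p) :
    IntegrableOn (logWeight p S j) (Set.Ioi 1) := by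
  have hε : 0 < (p - j - 1) / 2 := by linarith
  refine Integrable.mono' (g := fun t => t ^ (-(p - j - (p - j - 1) / 2)) / ((p - j - 1) / 2)
    + |S| * t ^ (-(p - j))) ?_ (measurable_logWeight p S j).aestronglyMeasurable ?_
  · exact ((integrableOn_Ioi_rpow_of_lt (by linarith) one_pos).div_const _).add
      ((integrableOn_Ioi_rpow_of_lt (by linarith) one_pos).const_mul _)
  · filter_upwards [ae_restrict_mem measurableSet_Ioi] with t ht
    exact abs_logWeight_le p S j hε (le_of_lt ht)

lemma tendsto_logWeight_atTop {p : ℝ} (S : ℝ) {j : ℕ} (hp : j < p) :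
    Filter.Tendsto (logWeight p S j) Filter.atTop (nhds 0) := by
  have hε : 0 < (p - j) / 2 := by linarith
  refine squeeze_zero_norm' (a := fun t => t ^ (-(p - j - (p - j) / 2)) / ((p - j) / 2)
    + |S| * t ^ (-(p - j))) ?_ ?_
  · filter_upwards [Filter.eventually_ge_atTop 1] with t ht
    exact abs_logWeight_le p S j hε ht
  · simpa using ((tendsto_rpow_neg_atTop (by linarith : 0 < p - j - (p - j) / 2)).div_const
      ((p - j) / 2)).add ((tendsto_rpow_neg_atTop (by linarith : 0 < p - j)).const_mul |S|)

lemma integral_Ioi_logWeight_zero {p : ℝ} (hp : 0 < p) (S : ℝ) {a : ℝ} (ha : 1 ≤ a) :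
    ∫ t in Set.Ioi a, p * logWeight (p + 1) (S + 1 / p) 0 t = logWeight p S 0 a := by
  have hi : IntegrableOn (fun t => -p * logWeight (p + 1) (S + 1 / p) 0 t) (Set.Ioi a) :=
    ((integrableOn_logWeight (S + 1 / p) (j := 0) (by simpa using hp)).mono_set
      (Set.Ioi_subset_Ioi ha)).const_mul _
  have h := integral_Ioi_of_hasDerivAt_of_tendsto' (f := logWeight p S 0) (a := a)
    (f' := fun t => -p * logWeight (p + 1) (S + 1 / p) 0 t)
    (fun t ht => by
      simpa using hasDerivAt_logWeight hp.ne' S 0 (by linarith [Set.mem_Ici.1 ht] : 0 < t)) hi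
    (tendsto_logWeight_atTop S (j := 0) (by simpa using hp))
  simp only [neg_mul, integral_neg] at h
  linarith

/-- The logarithmic mean of the density proportional to `t ^ (-(p + 1)) * (t - 1) ^ j` on `(1, ∞)`
is `∑ i ≤ j, 1 / (p - i)`; the proof is an integration by parts that lowers `p` and `j` by one. -/
lemma integral_logWeight_harmonic (j : ℕ) {p : ℝ} (hp : j < p) :
    ∫ t in Set.Ioi 1, logWeight (p + 1) (∑ i ∈ Finset.range (j + 1), 1 / (p - i)) j t = 0 := by
  induction j generalizing p with
  | zero =>
    have hp0 : 0 < p := by simpa using hp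
    have h := integral_Ioi_logWeight_zero hp0 0 le_rfl
    rw [integral_const_mul] at h
    have h0 : logWeight p 0 0 1 = 0 := by simp [logWeight]
    rw [h0, zero_add] at h
    simpa [hp0.ne'] using h
  | succ j ih =>
    push_cast at hp
    have hj : (0 : ℝ) ≤ j := Nat.cast_nonneg j
    have hp0 : 0 < p := by linarith
    set S := ∑ i ∈ Finset.range (j + 1), 1 / (p - 1 - i) with hS
    have hsum : ∑ i ∈ Finset.range (j + 1 + 1), 1 / (p - (i : ℕ)) = S + 1 / p := by
      rw [Finset.sum_range_succ', hS]
      congr 1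
      · exact Finset.sum_congr rfl fun i _ => by push_cast; ring_nf
      · simp
    have hIH : ∫ t in Set.Ioi 1, logWeight p S j t = 0 := by
      simpa [hS] using ih (p := p - 1) (by linarith)
    have i1 : IntegrableOn (fun t => -p * logWeight (p + 1) (S + 1 / p) (j + 1) t)
        (Set.Ioi 1) := (integrableOn_logWeight _ (by push_cast; linarith)).const_mul _
    have i2 : IntegrableOn (fun t => ((j + 1 : ℕ) : ℝ) * logWeight p S j t) (Set.Ioi 1) :=
      (integrableOn_logWeight _ (by linarith)).const_mul _
    have h := integral_Ioi_of_hasDerivAt_of_tendsto' (f := logWeight p S (j + 1)) (a := 1)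
      (fun t ht => hasDerivAt_logWeight hp0.ne' S (j + 1)
        (by linarith [Set.mem_Ici.1 ht] : 0 < t))
      (i1.add i2) (tendsto_logWeight_atTop S (by push_cast; linarith))
    simp only [Nat.add_sub_cancel] at h
    rw [integral_add i1 i2, integral_const_mul, integral_const_mul, hIH] at h
    have h0 : logWeight p S (j + 1) 1 = 0 := by simp [logWeight]
    rw [h0] at h
    rw [hsum]
    simpa [hp0.ne'] using h

/-! ### Comparison with the extremal distribution function `(t - 1) ^ n` -/

section Comparison

variable {n : ℕ} {V : ℝ → ℝ}

/-- The kernel `logWeight p S 0` changes sign once, at `exp S`, from negative to positive. If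
`V t / (t - 1) ^ n` is nonincreasing, replacing it by its value at `exp S` increases the product. -/
lemma logWeight_zero_mul_le (hV : ∀ s t, 1 < s → s ≤ t → (s - 1) ^ n * V t ≤ (t - 1) ^ n * V s)
    (p : ℝ) {S : ℝ} (hS : 0 < S) {t : ℝ} (ht : 1 < t) :
    logWeight p S 0 t * V t ≤
      V (Real.exp S) / (Real.exp S - 1) ^ n * logWeight p S n t := by
  have ht0 : 0 < t := by linarith
  have hc : 1 < Real.exp S := Real.one_lt_exp_iff.2 hS
  have hcn : 0 < (Real.exp S - 1) ^ n := pow_pos (by linarith) n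
  rw [logWeight_eq_mul_pow p S n t]
  rw [show V (Real.exp S) / (Real.exp S - 1) ^ n * (logWeight p S 0 t * (t - 1) ^ n) =
    logWeight p S 0 t * ((t - 1) ^ n * V (Real.exp S) / (Real.exp S - 1) ^ n) by ring]
  have hw : logWeight p S 0 t = t ^ (-p) * (Real.log t - S) := by simp [logWeight]
  have hpos : 0 < t ^ (-p) := Real.rpow_pos_of_pos ht0 _
  rcases le_total t (Real.exp S) with h | h
  · refine mul_le_mul_of_nonpos_left ?_ ?_
    · exact (div_le_iff₀ hcn).2 (by linarith [hV t _ ht h])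
    · rw [hw]
      exact mul_nonpos_of_nonneg_of_nonpos hpos.le (by linarith [(Real.log_le_iff_le_exp ht0).2 h])
  · refine mul_le_mul_of_nonneg_left ?_ ?_
    · exact (le_div_iff₀ hcn).2 (by linarith [hV _ t hc h])
    · rw [hw]
      exact mul_nonneg hpos.le (by linarith [(Real.le_log_iff_exp_le ht0).2 h])

lemma integrableOn_logWeight_zero_mul (hmono : Monotone V) (hnn : ∀ t, 0 ≤ V t)
    (hV : ∀ s t, 1 < s → s ≤ t → (s - 1) ^ n * V t ≤ (t - 1) ^ n * V s)
    {p : ℝ} (S : ℝ) (hp : n + 1 < p) :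
    IntegrableOn (fun t => logWeight p S 0 t * V t) (Set.Ioi 1) := by
  have hn : (0 : ℝ) ≤ n := Nat.cast_nonneg n
  have i0 := (integrableOn_logWeight S (j := 0) (p := p) (by push_cast; linarith)).norm
  have i1 := (integrableOn_logWeight S hp).norm
  refine Integrable.mono' ((i0.mul_const (V 2)).add (i1.mul_const (V 2)))
    ((measurable_logWeight p S 0).mul hmono.measurable).aestronglyMeasurable ?_
  filter_upwards [ae_restrict_mem measurableSet_Ioi] with t ht
  have ht1 : 0 < t - 1 := sub_pos.2 ht
  have hbound : V t ≤ V 2 + (t - 1) ^ n * V 2 := by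
    rcases le_total t 2 with h | h
    · have := hmono h
      have := mul_nonneg (pow_nonneg ht1.le n) (hnn 2)
      linarith
    · have := hV 2 t (by norm_num) h
      norm_num at this
      linarith [hnn 2]
  simp only [Pi.add_apply]
  rw [logWeight_eq_mul_pow p S n t, norm_mul, norm_mul, Real.norm_of_nonneg (hnn t),
    Real.norm_of_nonneg (pow_nonneg ht1.le n)]
  calc ‖logWeight p S 0 t‖ * V t ≤ ‖logWeight p S 0 t‖ * (V 2 + (t - 1) ^ n * V 2) := by gcongr
    _ = _ := by ring

end Comparison

/-- If `g ≥ 1` and `μ {g ≤ t} / (t - 1) ^ n` is nonincreasing, the logarithmic mean of `g` with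
respect to `g ^ (-β) μ` is at most `∑_{i=1}^n 1 / (β - i)`, its value in the extremal case
`μ {g ≤ t} = (t - 1) ^ n`.

The layer-cake formula turns `∫ logWeight β C 0 (g x) ∂μ` into the integral over `τ > 1` of
`-(d/dτ) (logWeight β C 0 τ)` times the distribution function of `g`. -/
theorem integral_logWeight_comp_nonpos {α : Type*} [MeasurableSpace α] (μ : Measure α) [SFinite μ]
    {g : α → ℝ} (hg : Measurable g) (hg1 : ∀ x, 1 ≤ g x) (hfin : ∀ t, μ {x | g x ≤ t} ≠ ⊤) {n : ℕ}
    (hV : ∀ s t, 1 < s → s ≤ t →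
      (s - 1) ^ n * μ.real {x | g x ≤ t} ≤ (t - 1) ^ n * μ.real {x | g x ≤ s})
    {β : ℝ} (hβ : n < β) :
    Integrable (fun x => logWeight β (∑ i ∈ Finset.range n, 1 / (β - (i + 1))) 0 (g x)) μ ∧
      ∫ x, logWeight β (∑ i ∈ Finset.range n, 1 / (β - (i + 1))) 0 (g x) ∂μ ≤ 0 := by
  set C := ∑ i ∈ Finset.range n, 1 / (β - (i + 1)) with hC
  set V : ℝ → ℝ := fun t => μ.real {x | g x ≤ t} with hVdef
  have hβ0 : 0 < β := lt_of_le_of_lt (Nat.cast_nonneg n) hβ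
  have hCS : ∑ i ∈ Finset.range (n + 1), 1 / (β - i) = C + 1 / β := by
    rw [Finset.sum_range_succ', hC]
    push_cast
    simp
  have hC0 : 0 ≤ C := by
    refine Finset.sum_nonneg fun i hi => ?_
    have : (i : ℝ) + 1 ≤ n := by exact_mod_cast Finset.mem_range.1 hi
    exact one_div_nonneg.2 (by linarith)
  have hS : 0 < C + 1 / β := by positivity
  have hmono : Monotone V := fun s t hst =>
    measureReal_mono (fun x (hx : g x ≤ s) => hx.trans hst) (hfin t)
  have hnn : ∀ t, 0 ≤ V t := fun t => measureReal_nonneg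
  set w : ℝ → ℝ := fun t => β * logWeight (β + 1) (C + 1 / β) 0 t with hw
  have hwm : Measurable w := (measurable_logWeight _ _ _).const_mul β
  set ν := (volume : Measure ℝ).restrict (Set.Ioi 1) with hν
  set F : α × ℝ → ℝ := Set.indicator {q | g q.1 ≤ q.2} fun q => w q.2 with hF
  have hset : MeasurableSet {q : α × ℝ | g q.1 ≤ q.2} :=
    measurableSet_le (hg.comp measurable_fst) measurable_snd
  have hFm : Measurable F := (hwm.comp measurable_snd).indicator hset
  have hsec : ∀ t, MeasurableSet {x | g x ≤ t} := fun t => measurableSet_le hg measurable_const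
  have hFt : ∀ t, (fun x => F (x, t)) = Set.indicator {x | g x ≤ t} fun _ => w t := by
    intro t; ext x; simp [hF, Set.indicator_apply]
  have hFx : ∀ x, (fun t => F (x, t)) = Set.indicator (Set.Ici (g x)) w := by
    intro x; ext t; simp [hF, Set.indicator_apply]
  have hFint : ∀ t, ∫ x, F (x, t) ∂μ = w t * V t := by
    intro t
    rw [hFt, integral_indicator_const _ (hsec t), smul_eq_mul, mul_comm]
  have hFnorm : ∀ t, ∫ x, ‖F (x, t)‖ ∂μ = |w t| * V t := by
    intro t
    have : (fun x => ‖F (x, t)‖) = Set.indicator {x | g x ≤ t} fun _ => |w t| := by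
      ext x; rw [congrFun (hFt t) x, norm_indicator_eq_indicator_norm]; rfl
    rw [this, integral_indicator_const _ (hsec t), smul_eq_mul, mul_comm]
  have hwV : Integrable (fun t => w t * V t) ν := by
    have := (integrableOn_logWeight_zero_mul hmono hnn hV (p := β + 1) (C + 1 / β)
      (by linarith)).const_mul β
    refine this.congr (ae_of_all _ fun t => ?_)
    simp only [hw]; ring
  have hint : Integrable F (μ.prod ν) := by
    rw [integrable_prod_iff' hFm.aestronglyMeasurable]
    refine ⟨ae_of_all _ fun t => ?_, ?_⟩
    · rw [hFt]
      exact (integrable_indicator_iff (hsec t)).2 (integrableOn_const (hfin t))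
    · refine hwV.norm.congr (ae_of_all _ fun t => ?_)
      change ‖w t * V t‖ = ∫ x, ‖F (x, t)‖ ∂μ
      rw [hFnorm, norm_mul, Real.norm_eq_abs, Real.norm_of_nonneg (hnn t)]
  have hinner : ∀ x, ∫ t, F (x, t) ∂ν = logWeight β C 0 (g x) := by
    intro x
    rw [hFx, hν, setIntegral_indicator measurableSet_Ici]
    have : (Set.Ioi 1 ∩ Set.Ici (g x) : Set ℝ) =ᵐ[volume] Set.Ioi (g x) := by
      have h1 : Set.Ioi 1 ∩ Set.Ioi (g x) = Set.Ioi (g x) :=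
        Set.inter_eq_right.2 (Set.Ioi_subset_Ioi (hg1 x))
      have h2 : (Set.Ioi 1 ∩ Set.Ici (g x) : Set ℝ) =ᵐ[volume] (Set.Ioi 1 ∩ Set.Ioi (g x) : Set ℝ) :=
        (Filter.EventuallyEq.refl _ _).inter Ioi_ae_eq_Ici.symm
      rwa [h1] at h2
    rw [setIntegral_congr_set this]
    exact integral_Ioi_logWeight_zero hβ0 C (hg1 x)
  refine ⟨?_, ?_⟩
  · simpa only [hinner] using hint.integral_prod_left
  · have hswap := integral_integral_swap (f := fun x t => F (x, t)) hint
    simp only [hinner, hFint] at hswap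
    rw [hswap]
    have hzero := integral_logWeight_harmonic n hβ
    rw [hCS] at hzero
    set k := V (Real.exp (C + 1 / β)) / (Real.exp (C + 1 / β) - 1) ^ n
    calc ∫ t, w t * V t ∂ν
        ≤ ∫ t, β * k * logWeight (β + 1) (C + 1 / β) n t ∂ν := by
          refine setIntegral_mono_on hwV ((integrableOn_logWeight _ (by linarith)).const_mul _)
            measurableSet_Ioi fun t ht => ?_
          have := mul_le_mul_of_nonneg_left
            (logWeight_zero_mul_le hV (β + 1) hS ht) hβ0.le
          simp only [hw]
          linarith
      _ = 0 := by rw [integral_const_mul, hzero, mul_zero]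

/-! ### Sublevel sets of convex functions -/

section Sublevel

variable {E : Type*} [NormedAddCommGroup E] [NormedSpace ℝ E] [MeasurableSpace E]
  [FiniteDimensional ℝ E] (μ : Measure E) [μ.IsAddHaarMeasure] {Ω : Set E} {φ : E → ℝ}

/-- Sublevel sets strictly above the infimum have positive measure. -/
lemma ConvexOn.measure_sublevel_pos (hφ : ConvexOn ℝ Ω φ) (hΩ : IsOpen Ω) {m : ℝ}
    (hm : IsGLB (φ '' Ω) m) {t : ℝ} (ht : m < t) : 0 < μ {x ∈ Ω | φ x < t} := by
  obtain ⟨_, ⟨x₀, hx₀, rfl⟩, -, hlt⟩ := hm.exists_between ht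
  exact ((hφ.continuousOn hΩ).isOpen_inter_preimage hΩ isOpen_Iio).measure_pos μ ⟨x₀, hx₀, hlt⟩

variable [BorelSpace E]

/-- A homothety centred at `x₀` with ratio `r ≤ 1` maps one sublevel set into another. -/
lemma ConvexOn.measure_sublevel_scaling (hφ : ConvexOn ℝ Ω φ) {x₀ : E} (hx₀ : x₀ ∈ Ω) {r : ℝ}
    (hr0 : 0 ≤ r) (hr1 : r ≤ 1) (t : ℝ) :
    ENNReal.ofReal (r ^ Module.finrank ℝ E) * μ {x ∈ Ω | φ x ≤ t} ≤
      μ {x ∈ Ω | φ x ≤ (1 - r) * φ x₀ + r * t} := by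
  have h := Measure.addHaar_image_homothety μ x₀ r {x ∈ Ω | φ x ≤ t}
  rw [abs_of_nonneg (pow_nonneg hr0 _)] at h
  rw [← h]
  refine measure_mono ?_
  rintro _ ⟨x, ⟨hx, hxt⟩, rfl⟩
  have e : AffineMap.homothety x₀ r x = (1 - r) • x₀ + r • x := by
    rw [AffineMap.homothety_eq_lineMap, AffineMap.lineMap_apply_module]
  rw [e]
  refine ⟨hφ.1 hx₀ hx (by linarith) hr0 (by ring), ?_⟩
  refine (hφ.2 hx₀ hx (by linarith) hr0 (by ring)).trans ?_
  simp only [smul_eq_mul]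
  gcongr

/-- If `m` is the infimum of the convex function `φ`, then `μ {φ ≤ t} / (t - m) ^ d` is
nonincreasing in `t > m`, where `d` is the dimension. -/
lemma ConvexOn.measureReal_sublevel_mono (hφ : ConvexOn ℝ Ω φ) {m : ℝ}
    (hm : IsGLB (φ '' Ω) m) (hfin : ∀ t, μ {x ∈ Ω | φ x ≤ t} ≠ ⊤) {s t : ℝ} (hs : m < s)
    (hst : s ≤ t) :
    (s - m) ^ Module.finrank ℝ E * μ.real {x ∈ Ω | φ x ≤ t} ≤
      (t - m) ^ Module.finrank ℝ E * μ.real {x ∈ Ω | φ x ≤ s} := by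
  rcases hst.eq_or_lt with rfl | hst
  · exact le_rfl
  have htm : 0 < t - m := by linarith
  set ρ := (s - m) / (t - m) with hρ
  have hρ0 : 0 < ρ := div_pos (by linarith) htm
  have hρ1 : ρ < 1 := (div_lt_one htm).2 (by linarith)
  have key : ∀ r ∈ Set.Ioo 0 ρ,
      r ^ Module.finrank ℝ E * μ.real {x ∈ Ω | φ x ≤ t} ≤ μ.real {x ∈ Ω | φ x ≤ s} := by
    rintro r ⟨hr0, hr⟩
    have hr1 : 0 < 1 - r := by linarith
    have hrs : r * (t - m) < s - m := (lt_div_iff₀ htm).1 hr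
    -- a centre `x₀` with `(1 - r) * φ x₀ + r * t < s` exists since the infimum `m` satisfies this
    obtain ⟨_, ⟨x₀, hx₀, rfl⟩, -, hlt⟩ := hm.exists_between (b := (s - r * t) / (1 - r))
      ((lt_div_iff₀ hr1).2 (by linarith))
    have h := hφ.measure_sublevel_scaling μ hx₀ hr0.le (by linarith) t
    have h' := h.trans (measure_mono (t := {x ∈ Ω | φ x ≤ s}) fun x hx =>
      ⟨hx.1, hx.2.trans (by linarith [(lt_div_iff₀ hr1).1 hlt])⟩)
    have h'' := ENNReal.toReal_mono (hfin s) h'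
    rwa [ENNReal.toReal_mul, ENNReal.toReal_ofReal (by positivity)] at h''
  have hlim : ρ ^ Module.finrank ℝ E * μ.real {x ∈ Ω | φ x ≤ t} ≤ μ.real {x ∈ Ω | φ x ≤ s} := by
    have hc : Filter.Tendsto
        (fun r : ℝ => r ^ Module.finrank ℝ E * μ.real {x ∈ Ω | φ x ≤ t})
        (nhdsWithin ρ (Set.Iio ρ)) (nhds (ρ ^ Module.finrank ℝ E * μ.real {x ∈ Ω | φ x ≤ t})) :=
      Continuous.tendsto' (by fun_prop) _ _ rfl |>.mono_left nhdsWithin_le_nhds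
    refine le_of_tendsto hc ?_
    filter_upwards [Ioo_mem_nhdsLT hρ0] with r hr using key r hr
  calc (s - m) ^ Module.finrank ℝ E * μ.real {x ∈ Ω | φ x ≤ t}
      = (t - m) ^ Module.finrank ℝ E * (ρ ^ Module.finrank ℝ E * μ.real {x ∈ Ω | φ x ≤ t}) := by
        rw [← mul_assoc, ← mul_pow, hρ, mul_div_cancel₀ _ htm.ne']
    _ ≤ _ := by gcongr

end Sublevel

/-! ### Integrable negative powers of convex functions -/

lemma sublevel_subset_superlevel_rpow {E : Type*} {Ω : Set E} {φ f : E → ℝ} {β : ℝ}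
    (hφ0 : ∀ x ∈ Ω, 0 < φ x) (hβ : 0 ≤ β)
    (hf : ∀ x ∈ Ω, f x = φ x ^ (-β)) (t : ℝ) :
    {x ∈ Ω | φ x ≤ t} ⊆ {x | t ^ (-β) ≤ f x} := by
  rintro x ⟨hx, hxt⟩
  rw [Set.mem_ofPred_eq, hf x hx]
  exact Real.rpow_le_rpow_of_nonpos (hφ0 x hx) hxt (by linarith)

lemma measure_sublevel_ne_top {E : Type*} [MeasurableSpace E] {μ : Measure E} {Ω : Set E}
    {φ f : E → ℝ} {β : ℝ} (hφ0 : ∀ x ∈ Ω, 0 < φ x) (hβ : 0 ≤ β)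
    (hf : ∀ x ∈ Ω, f x = φ x ^ (-β)) (hfi : Integrable f μ) (t : ℝ) :
    μ {x ∈ Ω | φ x ≤ t} ≠ ⊤ := by
  have h1 : {x ∈ Ω | φ x ≤ t} ⊆ {x | max t 1 ^ (-β) ≤ f x} := fun x hx =>
    sublevel_subset_superlevel_rpow hφ0 hβ hf _ ⟨hx.1, hx.2.trans (le_max_left _ _)⟩
  have h2 : 0 < max t 1 ^ (-β) := Real.rpow_pos_of_pos (by positivity) _
  exact ((measure_mono h1).trans_lt (hfi.measure_ge_lt_top h2)).ne

section ConvexPower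

variable {E : Type*} [NormedAddCommGroup E] [NormedSpace ℝ E] [MeasurableSpace E]
  [FiniteDimensional ℝ E] {μ : Measure E} [μ.IsAddHaarMeasure] {Ω : Set E} {φ f : E → ℝ} {β : ℝ}

lemma ConvexOn.eLpNorm_top_rpow (hφ : ConvexOn ℝ Ω φ) (hΩ : IsOpen Ω)
    (hφ0 : ∀ x ∈ Ω, 0 < φ x) (hβ : 0 < β) (hf : ∀ x ∈ Ω, f x = φ x ^ (-β))
    (hf0 : ∀ x ∉ Ω, f x = 0) {m : ℝ} (hm : IsGLB (φ '' Ω) m) (hm0 : 0 < m) :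
    eLpNorm f ⊤ μ = ENNReal.ofReal (m ^ (-β)) := by
  have hmβ : 0 < m ^ (-β) := Real.rpow_pos_of_pos hm0 _
  refine le_antisymm ?_ ?_
  · rw [eLpNorm_exponent_top]
    refine eLpNormEssSup_le_of_ae_bound (ae_of_all _ fun x => ?_)
    by_cases hx : x ∈ Ω
    · rw [hf x hx, Real.norm_of_nonneg (Real.rpow_nonneg (hφ0 x hx).le _)]
      exact Real.rpow_le_rpow_of_nonpos hm0 (hm.1 ⟨x, hx, rfl⟩) (by linarith)
    · rw [hf0 x hx, norm_zero]; exact hmβ.le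
  · by_contra! hlt
    have hne : eLpNorm f ⊤ μ ≠ ⊤ := hlt.ne_top
    set M := (eLpNorm f ⊤ μ).toReal with hM
    have hMlt : M < m ^ (-β) := (ENNReal.lt_ofReal_iff_toReal_lt hne).1 hlt
    -- by continuity of `t ↦ t ^ (-β)` at `m`, the function `f` exceeds `M` on a set `{φ < t}`
    obtain ⟨t, hmt, ht⟩ : ∃ t, m < t ∧ M < t ^ (-β) := by
      have hc : ContinuousAt (fun t : ℝ => t ^ (-β)) m :=
        Real.continuousAt_rpow_const _ _ (Or.inl hm0.ne')
      have h1 := (hc.eventually (lt_mem_nhds hMlt)).filter_mono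
        (nhdsWithin_le_nhds (s := Set.Ioi m))
      obtain ⟨t, ht⟩ := (h1.and self_mem_nhdsWithin).exists
      exact ⟨t, ht.2, ht.1⟩
    have hsub : {x ∈ Ω | φ x < t} ⊆ {x | eLpNormEssSup f μ < ‖f x‖ₑ} := by
      rintro x ⟨hx, hxt⟩
      have h1 : M < ‖f x‖ := by
        rw [hf x hx, Real.norm_of_nonneg (Real.rpow_nonneg (hφ0 x hx).le _)]
        exact ht.trans_le (Real.rpow_le_rpow_of_nonpos (hφ0 x hx) hxt.le (by linarith))
      rw [Set.mem_ofPred_eq, ← eLpNorm_exponent_top, ← ofReal_norm]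
      exact (ENNReal.lt_ofReal_iff_toReal_lt hne).2 h1
    have := (hφ.measure_sublevel_pos μ hΩ hm hmt).trans_le (measure_mono hsub)
    rw [meas_eLpNormEssSup_lt] at this
    exact lt_irrefl _ this

variable [BorelSpace E]

/-- A convex function whose power `φ ^ (-β)` is integrable, with `β` larger than the dimension, is
bounded away from zero: if `φ` had infimum `0`, then `μ {φ ≤ s}` would be at least of order `s ^ d`,
whereas it is at most of order `s ^ β` by Markov's inequality. -/
lemma ConvexOn.pos_of_isGLB_of_integrable_rpow (hφ : ConvexOn ℝ Ω φ) (hΩ : IsOpen Ω)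
    (hφ0 : ∀ x ∈ Ω, 0 < φ x) (hβ : Module.finrank ℝ E < β) (hf : ∀ x ∈ Ω, f x = φ x ^ (-β))
    (hf0 : ∀ x ∉ Ω, f x = 0) (hfi : Integrable f μ) {m : ℝ} (hm : IsGLB (φ '' Ω) m) :
    0 < m := by
  have hβ0 : 0 < β := lt_of_le_of_lt (Nat.cast_nonneg _) hβ
  have hm0 : 0 ≤ m := hm.2 (Set.forall_mem_image.2 fun x hx => (hφ0 x hx).le)
  refine hm0.lt_of_ne fun h => ?_
  subst h
  have hfin := measure_sublevel_ne_top hφ0 hβ0.le hf hfi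
  have hfnn : ∀ x, 0 ≤ f x := fun x => by
    by_cases hx : x ∈ Ω
    · rw [hf x hx]; exact Real.rpow_nonneg (hφ0 x hx).le _
    · rw [hf0 x hx]
  set V : ℝ → ℝ := fun t => μ.real {x ∈ Ω | φ x ≤ t} with hV
  have hV1 : 0 < V 1 := by
    refine ENNReal.toReal_pos ?_ (hfin 1)
    exact ((hφ.measure_sublevel_pos μ hΩ hm one_pos).trans_le
      (measure_mono (t := {x ∈ Ω | φ x ≤ 1}) fun x hx => ⟨hx.1, le_of_lt hx.2⟩)).ne'
  have key : ∀ s ∈ Set.Ioo (0 : ℝ) 1, V 1 ≤ s ^ (β - Module.finrank ℝ E) * ∫ x, f x ∂μ := by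
    rintro s ⟨hs0, hs1⟩
    have h1 := hφ.measureReal_sublevel_mono μ hm hfin hs0 hs1.le
    simp only [sub_zero, one_pow, one_mul] at h1
    have h2 : s ^ (-β) * V s ≤ ∫ x, f x ∂μ := by
      refine le_trans ?_ (mul_meas_ge_le_integral_of_nonneg (ae_of_all _ hfnn) hfi (s ^ (-β)))
      refine mul_le_mul_of_nonneg_left ?_ (Real.rpow_nonneg hs0.le _)
      exact measureReal_mono (sublevel_subset_superlevel_rpow hφ0 hβ0.le hf s)
        (hfi.measure_ge_lt_top (Real.rpow_pos_of_pos hs0 _)).ne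
    have hsd : 0 < s ^ Module.finrank ℝ E := pow_pos hs0 _
    have hsβ : 0 < s ^ β := Real.rpow_pos_of_pos hs0 _
    rw [Real.rpow_neg hs0.le, inv_mul_le_iff₀ hsβ] at h2
    rw [Real.rpow_sub hs0, Real.rpow_natCast, div_mul_eq_mul_div, le_div_iff₀ hsd]
    linarith
  have hlim : Filter.Tendsto (fun s : ℝ => s ^ (β - Module.finrank ℝ E) * ∫ x, f x ∂μ)
      (nhdsWithin 0 (Set.Ioi 0)) (nhds 0) := by
    have hp : 0 < β - Module.finrank ℝ E := by linarith
    refine Filter.Tendsto.mono_left (Continuous.tendsto' ?_ _ _ ?_) nhdsWithin_le_nhds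
    · exact (Real.continuous_rpow_const hp.le).mul continuous_const
    · simp [Real.zero_rpow hp.ne']
  have := ge_of_tendsto hlim (by filter_upwards [Ioo_mem_nhdsGT one_pos] with s hs using key s hs)
  linarith

/-- The entropy bound `h(f) ≤ β (log m + ∑_{i=1}^d 1 / (β - i))` for a probability density
`f = φ ^ (-β)` with `m = inf φ`, where `d` is the dimension. -/
theorem ConvexOn.entropy_rpow_le (hφ : ConvexOn ℝ Ω φ) (hΩ : IsOpen Ω)
    (hφ0 : ∀ x ∈ Ω, 0 < φ x) (hβ : Module.finrank ℝ E < β) (hf : ∀ x ∈ Ω, f x = φ x ^ (-β))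
    (hf0 : ∀ x ∉ Ω, f x = 0) (hfi : Integrable f μ) (hf1 : ∫ x, f x ∂μ = 1) {m : ℝ}
    (hm : IsGLB (φ '' Ω) m) :
    Integrable (fun x => f x * Real.log (f x)) μ ∧
      -∫ x, f x * Real.log (f x) ∂μ ≤
        β * (Real.log m + ∑ i ∈ Finset.range (Module.finrank ℝ E), 1 / (β - (i + 1))) := by
  classical
  have hβ0 : 0 < β := lt_of_le_of_lt (Nat.cast_nonneg _) hβ
  have hm0 := hφ.pos_of_isGLB_of_integrable_rpow hΩ hφ0 hβ hf hf0 hfi hm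
  have hfin := measure_sublevel_ne_top hφ0 hβ0.le hf hfi
  set g : E → ℝ := Ω.piecewise (fun x => φ x / m) fun _ => 1 with hg
  have hgΩ : ∀ x ∈ Ω, g x = φ x / m := fun x hx => Set.piecewise_eq_of_mem _ _ _ hx
  have hgm : Measurable g := ContinuousOn.measurable_piecewise
    ((hφ.continuousOn hΩ).div_const m) continuousOn_const hΩ.measurableSet
  have hg1 : ∀ x, 1 ≤ g x := fun x => by
    by_cases hx : x ∈ Ω
    · rw [hgΩ x hx, one_le_div hm0]; exact hm.1 ⟨x, hx, rfl⟩
    · simp [hg, hx]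
  have hsub : ∀ t, μ.restrict Ω {x | g x ≤ t} = μ {x ∈ Ω | φ x ≤ m * t} := by
    intro t
    rw [Measure.restrict_apply (measurableSet_le hgm measurable_const)]
    congr 1
    ext x
    simp only [Set.mem_inter_iff, Set.mem_ofPred_eq]
    rw [and_comm]
    refine and_congr_right fun hx => ?_
    rw [hgΩ x hx, div_le_iff₀ hm0, mul_comm]
  have hmono : ∀ s t, 1 < s → s ≤ t →
      (s - 1) ^ Module.finrank ℝ E * (μ.restrict Ω).real {x | g x ≤ t} ≤
        (t - 1) ^ Module.finrank ℝ E * (μ.restrict Ω).real {x | g x ≤ s} := by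
    intro s t hs hst
    have h := hφ.measureReal_sublevel_mono μ hm hfin (s := m * s) (t := m * t)
      (by nlinarith) (by gcongr)
    rw [show m * s - m = m * (s - 1) by ring, show m * t - m = m * (t - 1) by ring, mul_pow,
      mul_pow, mul_assoc, mul_assoc] at h
    simp only [measureReal_def, hsub]
    exact le_of_mul_le_mul_left h (pow_pos hm0 _)
  obtain ⟨hi, hle⟩ := integral_logWeight_comp_nonpos (μ.restrict Ω) hgm hg1
    (fun t => by rw [hsub]; exact hfin _) hmono hβ
  set C := ∑ i ∈ Finset.range (Module.finrank ℝ E), 1 / (β - (i + 1)) with hC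
  have hpt : ∀ x ∈ Ω, f x * Real.log (f x) =
      -β * (m ^ (-β) * logWeight β C 0 (g x) + (Real.log m + C) * f x) := by
    intro x hx
    have hx0 := hφ0 x hx
    have hgx : φ x = m * g x := by rw [hgΩ x hx, mul_div_cancel₀ _ hm0.ne']
    have hg0 : 0 < g x := by linarith [hg1 x]
    rw [hf x hx, Real.log_rpow hx0, hgx, Real.mul_rpow hm0.le hg0.le,
      Real.log_mul hm0.ne' hg0.ne', logWeight]
    ring
  have hsupp : ∀ x, x ∉ Ω → f x * Real.log (f x) = 0 := fun x hx => by rw [hf0 x hx, zero_mul]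
  have i1 : Integrable (fun x => m ^ (-β) * logWeight β C 0 (g x)) (μ.restrict Ω) :=
    hi.const_mul _
  have i2 : Integrable (fun x => (Real.log m + C) * f x) (μ.restrict Ω) :=
    hfi.restrict.const_mul _
  have hΩf : ∫ x in Ω, f x ∂μ = 1 := by
    rw [setIntegral_eq_integral_of_forall_compl_eq_zero hf0, hf1]
  constructor
  · rw [← integrableOn_iff_integrable_of_support_subset (s := Ω)
      (Function.support_subset_iff'.2 hsupp)]
    refine ((i1.add i2).const_mul (-β)).congr ?_
    filter_upwards [ae_restrict_mem hΩ.measurableSet] with x hx using (hpt x hx).symm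
  · rw [← setIntegral_eq_integral_of_forall_compl_eq_zero hsupp,
      setIntegral_congr_fun hΩ.measurableSet hpt, integral_const_mul, integral_add i1 i2,
      integral_const_mul, integral_const_mul, hΩf]
    have := mul_nonpos_of_nonneg_of_nonpos
      (mul_nonneg hβ0.le (Real.rpow_nonneg hm0.le (-β))) hle
    linarith

end ConvexPower

/-! ### The error terms -/

lemma sum_range_add_one_eq_sum_Icc {M : Type*} [AddCommMonoid M] (u : ℕ → M) (n : ℕ) :
    ∑ i ∈ Finset.range n, u (i + 1) = ∑ i ∈ Finset.Icc 1 n, u i := by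
  induction n with
  | zero => simp
  | succ n ih => rw [Finset.sum_range_succ, ih, Finset.sum_Icc_succ_top (by omega)]

lemma sum_one_div_add_le_log {b : ℝ} (hb : 0 < b) (n : ℕ) :
    ∑ j ∈ Finset.range (n + 1), 1 / (b + j) ≤ 1 / b + Real.log (1 + n / b) := by
  induction n with
  | zero => simp
  | succ n ih =>
    rw [Finset.sum_range_succ]
    have hn : 0 < b + n := by positivity
    have hn1 : 0 < b + n + 1 := by linarith
    have h := Real.one_sub_inv_le_log_of_pos (div_pos hn1 hn)
    have e : Real.log (1 + ((n + 1 : ℕ) : ℝ) / b) =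
        Real.log (1 + n / b) + Real.log ((b + n + 1) / (b + n)) := by
      rw [← Real.log_mul (by positivity) (by positivity)]
      congr 1
      push_cast
      field_simp
      ring
    have e2 : 1 - ((b + n + 1) / (b + n))⁻¹ = 1 / (b + ((n + 1 : ℕ) : ℝ)) := by
      push_cast
      rw [← add_assoc]
      field_simp
      ring
    rw [e]
    linarith

lemma errorSum_le_errorTerm {b : ℝ} (hb : 0 < b) {n : ℕ} (hn : 1 ≤ n) :
    errorSum b n ≤ errorTerm b n := by
  obtain ⟨k, rfl⟩ := Nat.exists_eq_add_of_le' hn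
  have hk : (0 : ℝ) < ((k + 1 : ℕ) : ℝ) := by positivity
  have h := sum_one_div_add_le_log hb k
  rw [← Finset.sum_range_reflect] at h
  have e : ∑ i ∈ Finset.Icc 1 (k + 1), 1 / (b + ((k + 1 : ℕ) : ℝ) - i) =
      ∑ j ∈ Finset.range (k + 1), 1 / (b + ((k + 1 - 1 - j : ℕ) : ℝ)) := by
    rw [← sum_range_add_one_eq_sum_Icc fun i : ℕ => 1 / (b + ((k + 1 : ℕ) : ℝ) - i)]
    refine Finset.sum_congr rfl fun j hj => ?_
    have hj' : j ≤ k := by have := Finset.mem_range.1 hj; omega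
    rw [Nat.add_sub_cancel, Nat.cast_sub hj']
    push_cast
    ring_nf
  rw [errorSum, errorTerm, e]
  have e2 : (b + ((k + 1 : ℕ) : ℝ)) / ((k + 1 : ℕ) : ℝ) = 1 + b / ((k + 1 : ℕ) : ℝ) := by
    field_simp
    ring
  rw [e2]
  refine mul_le_mul_of_nonneg_left ?_ (by positivity)
  simpa using h

lemma errorTerm_isBigO_log {b : ℝ} (hb : 1 ≤ b) :
    errorTerm b =O[Filter.atTop] fun n : ℕ => Real.log n := by
  refine Asymptotics.IsBigO.of_bound ((1 + b) * 2) ?_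
  filter_upwards [Filter.eventually_ge_atTop 3] with n hn
  have hb0 : 0 < b := by linarith
  have hn3 : (3 : ℝ) ≤ n := by exact_mod_cast hn
  have hlog1 : 1 ≤ Real.log n :=
    (Real.le_log_iff_exp_le (by linarith)).2 (by linarith [Real.exp_one_lt_d9])
  have hq : 0 ≤ ((n : ℝ) - 1) / b := div_nonneg (by linarith) hb0.le
  have h1 : Real.log (1 + ((n : ℝ) - 1) / b) ≤ Real.log n := by
    refine Real.log_le_log (by linarith) ?_
    linarith [div_le_self (by linarith : (0 : ℝ) ≤ n - 1) hb]
  have h0 : 0 ≤ Real.log (1 + ((n : ℝ) - 1) / b) := Real.log_nonneg (by linarith)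
  have h2 : 1 / b ≤ 1 := (div_le_one hb0).2 hb
  have h3 : b / n ≤ b := div_le_self hb0.le (by linarith)
  have h4 : 0 ≤ 1 / b := by positivity
  have h5 : 0 ≤ b / n := by positivity
  rw [Real.norm_of_nonneg (by linarith : 0 ≤ Real.log n), errorTerm,
    Real.norm_of_nonneg (mul_nonneg (by linarith) (by linarith)), mul_assoc]
  exact mul_le_mul (by linarith) (by linarith) (by linarith) (by linarith)

/-- `β / (β - a)` is nonincreasing in `β > a`, for `a ≥ 0`. -/
lemma mul_one_div_sub_anti {a b c : ℝ} (ha : 0 ≤ a) (hab : a < b) (hbc : b ≤ c) :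
    c * (1 / (c - a)) ≤ b * (1 / (b - a)) := by
  rw [mul_one_div, mul_one_div, div_le_div_iff₀ (by linarith) (by linarith)]
  nlinarith

lemma div_mul_sum_le_errorSum {n : ℕ} {b β : ℝ} (hb : 0 < b) (hβ : b + n ≤ β) :
    β / n * ∑ i ∈ Finset.range n, 1 / (β - (i + 1)) ≤ errorSum b n := by
  rw [errorSum, ← sum_range_add_one_eq_sum_Icc fun i : ℕ => 1 / (b + (n : ℝ) - i),
    div_mul_eq_mul_div, div_mul_eq_mul_div, Finset.mul_sum, Finset.mul_sum]
  refine div_le_div_of_nonneg_right (Finset.sum_le_sum fun i hi => ?_) (Nat.cast_nonneg n)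
  have : (i : ℝ) + 1 ≤ n := by exact_mod_cast Finset.mem_range.1 hi
  push_cast
  exact mul_one_div_sub_anti (by positivity) (by linarith) hβ

lemma div_mul_sum_le_of_mul_le {n : ℕ} (hn : 1 ≤ n) {b β : ℝ} (hb : 1 < b) (hβ : b * n ≤ β) :
    β / n * ∑ i ∈ Finset.range n, 1 / (β - (i + 1)) ≤ b / (b - 1) := by
  have hn0 : (0 : ℝ) < n := by exact_mod_cast hn
  have hβn : n < b * n := by nlinarith
  rw [div_mul_eq_mul_div, Finset.mul_sum, div_le_iff₀ hn0]
  have h : ∀ i ∈ Finset.range n, β * (1 / (β - ((i : ℝ) + 1))) ≤ b / (b - 1) := by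
    intro i hi
    have hi' : (i : ℝ) + 1 ≤ n := by exact_mod_cast Finset.mem_range.1 hi
    calc β * (1 / (β - ((i : ℝ) + 1))) ≤ β * (1 / (β - n)) :=
          mul_le_mul_of_nonneg_left
            (one_div_le_one_div_of_le (by linarith) (by linarith)) (by linarith)
      _ ≤ b * n * (1 / (b * n - n)) := mul_one_div_sub_anti hn0.le hβn hβ
      _ = b / (b - 1) := by
          have : b - 1 ≠ 0 := by linarith
          rw [show b * n - n = (b - 1) * n by ring]
          field_simp
  calc ∑ i ∈ Finset.range n, β * (1 / (β - ((i : ℝ) + 1)))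
      ≤ ∑ _i ∈ Finset.range n, b / (b - 1) := Finset.sum_le_sum h
    _ = b / (b - 1) * n := by rw [Finset.sum_const, Finset.card_range, nsmul_eq_mul, mul_comm]

/-! ### Entropy of random vectors with convex-power densities -/

section RandomVector

variable {n : ℕ} {β : ℝ} {f : EuclideanSpace ℝ (Fin n) → ℝ}

lemma IsConvexPower.measurable (h : IsConvexPower β f) : Measurable f := by
  classical
  obtain ⟨Ω, φ, hΩ, -, hφ0, hφ, hf, hf0⟩ := h
  have e : f = Ω.piecewise (fun x => φ x ^ (-β)) fun _ => 0 := by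
    ext x
    by_cases hx : x ∈ Ω
    · rw [Set.piecewise_eq_of_mem _ _ _ hx, hf x hx]
    · rw [Set.piecewise_eq_of_notMem _ _ _ hx, hf0 x hx]
  rw [e]
  refine ContinuousOn.measurable_piecewise ?_ continuousOn_const hΩ.measurableSet
  exact (hφ.continuousOn hΩ).rpow_const fun x hx => Or.inl (hφ0 x hx).ne'

lemma IsConvexPower.nonneg (h : IsConvexPower β f) (x : EuclideanSpace ℝ (Fin n)) : 0 ≤ f x := by
  obtain ⟨Ω, φ, -, -, hφ0, -, hf, hf0⟩ := h
  by_cases hx : x ∈ Ω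
  · rw [hf x hx]; exact Real.rpow_nonneg (hφ0 x hx).le _
  · rw [hf0 x hx]

/-- For a probability density `f = φ ^ (-β)` with `β > n`, the essential supremum and the
entropy of `f` are finite and `h(f) ≤ -log ‖f‖ + β * ∑_{i=1}^n 1 / (β - i)`. -/
theorem IsConvexPower.entropy_le (h : IsConvexPower β f) (hβ : n < β)
    (hfi : Integrable f) (hf1 : ∫ x, f x = 1) :
    MemLp f ⊤ volume ∧ 0 < maxDensity f ∧ Integrable (fun x => f x * Real.log (f x)) ∧
      densityEntropy f ≤
        -Real.log (maxDensity f) + β * ∑ i ∈ Finset.range n, 1 / (β - (i + 1)) := by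
  have hmeas := h.measurable
  obtain ⟨Ω, φ, hΩ, -, hφ0, hφ, hf, hf0⟩ := h
  have hβ0 : 0 < β := lt_of_le_of_lt (Nat.cast_nonneg _) hβ
  have hΩne : Ω.Nonempty := by
    by_contra hne
    rw [Set.not_nonempty_iff_eq_empty] at hne
    have : ∀ x, f x = 0 := fun x => hf0 x (by simp [hne])
    simp [this] at hf1
  have hbdd : BddBelow (φ '' Ω) := ⟨0, Set.forall_mem_image.2 fun x hx => (hφ0 x hx).le⟩
  have hm : IsGLB (φ '' Ω) (sInf (φ '' Ω)) := isGLB_csInf (hΩne.image φ) hbdd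
  have hd : Module.finrank ℝ (EuclideanSpace ℝ (Fin n)) = n := finrank_euclideanSpace_fin
  have hβ' : (Module.finrank ℝ (EuclideanSpace ℝ (Fin n)) : ℝ) < β := by rwa [hd]
  have hm0 := hφ.pos_of_isGLB_of_integrable_rpow hΩ hφ0 hβ' hf hf0 hfi hm
  set m := sInf (φ '' Ω)
  have hnorm : eLpNorm f ⊤ volume = ENNReal.ofReal (m ^ (-β)) :=
    hφ.eLpNorm_top_rpow hΩ hφ0 hβ0 hf hf0 hm hm0
  have hmax : maxDensity f = m ^ (-β) := by
    rw [maxDensity, hnorm, ENNReal.toReal_ofReal (Real.rpow_nonneg hm0.le _)]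
  obtain ⟨hint, hent⟩ := hφ.entropy_rpow_le hΩ hφ0 hβ' hf hf0 hfi hf1 hm
  refine ⟨⟨hmeas.aestronglyMeasurable, ?_⟩, ?_, hint, ?_⟩
  · rw [hnorm]; exact ENNReal.ofReal_lt_top
  · rw [hmax]; exact Real.rpow_pos_of_pos hm0 _
  · rw [hmax, Real.log_rpow hm0, densityEntropy]
    rw [hd] at hent
    linarith

variable {S : Type*} [MeasurableSpace S] {P : Measure S} [IsProbabilityMeasure P]
  {X : S → EuclideanSpace ℝ (Fin n)}

lemma HasDensity.lintegral_eq_one (h : HasDensity P X f) :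
    ∫⁻ x, ENNReal.ofReal (f x) = 1 := by
  have : IsProbabilityMeasure (P.map X) := Measure.isProbabilityMeasure_map h.1
  rw [← setLIntegral_univ, ← withDensity_apply _ MeasurableSet.univ, ← h.2, measure_univ]

lemma HasDensity.integrable (h : HasDensity P X f) (hf : Measurable f) (hf0 : ∀ x, 0 ≤ f x) :
    Integrable f := by
  refine ⟨hf.aestronglyMeasurable, ?_⟩
  rw [hasFiniteIntegral_iff_ofReal (ae_of_all _ hf0), h.lintegral_eq_one]
  exact ENNReal.one_lt_top

lemma HasDensity.integral_eq_one (h : HasDensity P X f) (hf : Measurable f)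
    (hf0 : ∀ x, 0 ≤ f x) : ∫ x, f x = 1 := by
  rw [integral_eq_lintegral_of_nonneg_ae (ae_of_all _ hf0) hf.aestronglyMeasurable,
    h.lintegral_eq_one, ENNReal.toReal_one]

lemma HasDensity.diffEntropy_eq (h : HasDensity P X f) (hf : Measurable f)
    (hf0 : ∀ x, 0 ≤ f x) : diffEntropy P X = densityEntropy f := by
  have hm : AEMeasurable (fun x => ENNReal.ofReal (f x)) volume := hf.ennreal_ofReal.aemeasurable
  have : HasPDF X P volume := hasPDF_of_map_eq_withDensity h.1 _ hm h.2
  have hae := (pdf.eq_of_map_eq_withDensity _ hm).1 h.2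
  rw [diffEntropy, densityEntropy, densityEntropy]
  congr 1
  refine integral_congr_ae ?_
  filter_upwards [hae] with x hx
  rw [hx, ENNReal.toReal_ofReal (hf0 x)]

theorem HasDensity.memLp_and_entropy (hX : HasDensity P X f) (h : IsConvexPower β f) (hβ : n < β) :
    MemLp f ⊤ volume ∧ 0 < maxDensity f ∧ Integrable (fun x => f x * Real.log (f x)) volume ∧
      diffEntropy P X = densityEntropy f := by
  obtain ⟨h1, h2, h3, -⟩ := h.entropy_le hβ (hX.integrable h.measurable h.nonneg)
    (hX.integral_eq_one h.measurable h.nonneg)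
  exact ⟨h1, h2, h3, hX.diffEntropy_eq h.measurable h.nonneg⟩

theorem HasDensity.diffEntropy_div_le (hX : HasDensity P X f) (h : IsConvexPower β f)
    (hβ : n < β) :
    1 / (n : ℝ) * diffEntropy P X ≤ Real.log (maxDensity f ^ (-(1 / (n : ℝ)))) +
      β / n * ∑ i ∈ Finset.range n, 1 / (β - (i + 1)) := by
  obtain ⟨-, h2, -, h4⟩ := h.entropy_le hβ (hX.integrable h.measurable h.nonneg)
    (hX.integral_eq_one h.measurable h.nonneg)
  rw [hX.diffEntropy_eq h.measurable h.nonneg, Real.log_rpow h2]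
  have := mul_le_mul_of_nonneg_left h4 (by positivity : (0 : ℝ) ≤ 1 / n)
  refine this.trans_eq ?_
  ring

end RandomVector

theorem mainTheorem5 :
    -- the norm and the entropy are finite, so that the inequalities below are meaningful
    (∀ (n : ℕ), 1 ≤ n → ∀ (β : ℝ), (n : ℝ) + 1 ≤ β →
      ∀ (S : Type*) [MeasurableSpace S] (P : Measure S) [IsProbabilityMeasure P]
        (X : S → EuclideanSpace ℝ (Fin n)) (f : EuclideanSpace ℝ (Fin n) → ℝ),
        HasDensity P X f → IsConvexPower β f →
          MemLp f ⊤ volume ∧ 0 < maxDensity f ∧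
            Integrable (fun x => f x * Real.log (f x)) volume ∧
            diffEntropy P X = densityEntropy f) ∧
    -- the range `β ≥ β₀ n`
    (∀ (β₀ : ℝ), 1 < β₀ → ∀ (n : ℕ), 1 ≤ n → ∀ (β : ℝ), (n : ℝ) + 1 ≤ β → β₀ * n ≤ β →
      ∀ (S : Type*) [MeasurableSpace S] (P : Measure S) [IsProbabilityMeasure P]
        (X : S → EuclideanSpace ℝ (Fin n)) (f : EuclideanSpace ℝ (Fin n) → ℝ),
        HasDensity P X f → IsConvexPower β f →
          1 / (n : ℝ) * diffEntropy P X ≤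
            β₀ / (β₀ - 1) + Real.log (maxDensity f ^ (-(1 / (n : ℝ))))) ∧
    -- the range `β ≥ β₀ + n`
    (∀ (β₀ : ℝ), 1 ≤ β₀ →
      (∀ (n : ℕ), 1 ≤ n → ∀ (β : ℝ), β₀ + n ≤ β →
        ∀ (S : Type*) [MeasurableSpace S] (P : Measure S) [IsProbabilityMeasure P]
          (X : S → EuclideanSpace ℝ (Fin n)) (f : EuclideanSpace ℝ (Fin n) → ℝ),
          HasDensity P X f → IsConvexPower β f →
            1 / (n : ℝ) * diffEntropy P X ≤
              Real.log (maxDensity f ^ (-(1 / (n : ℝ)))) + errorSum β₀ n) ∧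
      (∀ (n : ℕ), 1 ≤ n → errorSum β₀ n ≤ errorTerm β₀ n) ∧
      (errorTerm β₀ =O[Filter.atTop] fun n : ℕ => Real.log n)) := by
  refine ⟨?_, ?_, ?_⟩
  · intro n _ β hβ S _ P _ X f hX hf
    exact hX.memLp_and_entropy hf (by linarith)
  · intro β₀ hβ₀ n hn β hβ hβn S _ P _ X f hX hf
    have h := hX.diffEntropy_div_le hf (by linarith)
    linarith [div_mul_sum_le_of_mul_le hn hβ₀ hβn]
  · intro β₀ hβ₀
    refine ⟨?_, fun n hn => errorSum_le_errorTerm (by linarith) hn, errorTerm_isBigO_log hβ₀⟩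
    intro n _ β hβ S _ P _ X f hX hf
    have h := hX.diffEntropy_div_le hf (by linarith)
    linarith [div_mul_sum_le_errorSum (n := n) (by linarith : 0 < β₀) hβ]
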